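/- Let $p\in(0,1)$. There is a constant $C>0$ depending only on $p$ such that the following holds. For each $n$ let $\Omega_n=(\omega_{ij})\in\mathbb{R}^{n\times l_n}$ be a standardized Bernoulli matrix with parameter $p$, i.e. $\omega_{ij}=(b_{ij}-p)/\sqrt{p(1-p)}$, where the $b_{ij}$ are independent with $\mathbb{P}(b_{ij}=1)=p$ and $\mathbb{P}(b_{ij}=0)=1-p$ (the number of columns $l_n$ is arbitrary, e.g. constant, $l_n=l$). Let $U_n=(u^{(n)}_{ij})\in\mathbb{R}^{n\times n}$ be deterministic orthogonal matrices with $$\max_{1\le i,j\le n}|u^{(n)}_{ij}|\le\varepsilon_n,\qquad \varepsilon_n\to0\quad (n\to\infty).$$ Then: 1. $U_n\Omega_n$ converges in distribution to a standard Gaussian matrix (a matrix with independent $N(0,1)$ entries) as $n\to\infty$, in the sense of joint convergence of finite blocks of entries: for all fixed $r,s$, along any sizes $n\to\infty$ with $n\ge r$ and $l_n\ge s$, and for any choice of $r$ distinct rows and $s$ distinct columns (which may depend on $n$), the corresponding $r\times s$ submatrix of $U_n\Omega_n$ converges in distribution to an $r\times s$ standard Gaussian matrix. 2. For all $n$, all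 $i\le n$ and all $j\le l_n$, $$\sup_{x\in\mathbb{R}}\bigl|\mathbb{P}\bigl((U_n\Omega_n)_{ij}\le x\bigr)-\Phi(x)\bigr|\le C\sum_{k=1}^n|u^{(n)}_{ik}|^3,$$ where $\Phi$ is the distribution function of $N(0,1)$. -/

import Mathlib

open MeasureTheory ProbabilityTheory Filter Topology

/-- A random `n × l` real matrix `B` is a Bernoulli matrix with parameter `p` if its entries are
independent and each of them is `1` with probability `p` and `0` with probability `1 - p`. -/
structure IsBernoulliMatrix {S : Type*} [MeasurableSpace S] (P : Measure S) (p : unitInterval)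
    {n l : ℕ} (B : S → Matrix (Fin n) (Fin l) ℝ) : Prop where
  indep : iIndepFun (fun (a : Fin n × Fin l) (w : S) => B w a.1 a.2) P
  law : ∀ i j, HasLaw (fun w => B w i j) (bernoulliMeasure (1 : ℝ) 0 p) P

/-- A standardized Bernoulli matrix with parameter `p`: its entries are
`(b_ij - p) / √(p (1 - p))`, where `(b_ij)` is a Bernoulli matrix with parameter `p`. -/
def IsStandardizedBernoulliMatrix {S : Type*} [MeasurableSpace S] (P : Measure S)
    (p : unitInterval) {n l : ℕ} (Om : S → Matrix (Fin n) (Fin l) ℝ) : Prop :=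
  ∃ B : S → Matrix (Fin n) (Fin l) ℝ, IsBernoulliMatrix P p B ∧
    ∀ w i j, Om w i j = (B w i j - (p : ℝ)) / √((p : ℝ) * (1 - (p : ℝ)))

/-- The law of an `r × s` standard Gaussian matrix (independent `N(0,1)` entries), as a measure on
the space of real families indexed by the positions of the matrix. -/
noncomputable def standardGaussianMatrix (r s : ℕ) : Measure (Fin r × Fin s → ℝ) :=
  Measure.pi fun _ => gaussianReal 0 1

instance (r s : ℕ) : IsProbabilityMeasure (standardGaussianMatrix r s) := by
  unfold standardGaussianMatrix; infer_instance

/-- A sequence of random matrices `Y n` of size `n × l n` converges in distribution to a standard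
Gaussian matrix as `n → ∞`: for all fixed `r`, `s`, the `r × s` submatrices converge in
distribution (jointly in all entries) to an `r × s` standard Gaussian matrix, whatever `r` distinct
rows and `s` distinct columns are selected. The selected positions may depend on the size, and the
sizes `φ k` may run to infinity in any way (so that only sizes large enough to contain `r` rows and
`s` columns are involved). If `l n = l` for all `n`, the choice `s = l` gives `r × l` blocks of
complete rows. -/
def TendstoStandardGaussianMatrix {S : ℕ → Type*} [∀ n, MeasurableSpace (S n)]
    (P : ∀ n, Measure (S n)) [∀ n, IsProbabilityMeasure (P n)] {l : ℕ → ℕ}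
    (Y : ∀ n, S n → Matrix (Fin n) (Fin (l n)) ℝ) : Prop :=
  ∀ (r s : ℕ) (φ : ℕ → ℕ), Tendsto φ atTop atTop →
    ∀ (ρ : ∀ k, Fin r ↪ Fin (φ k)) (κ : ∀ k, Fin s ↪ Fin (l (φ k))),
      TendstoInDistribution
        (fun k (w : S (φ k)) (a : Fin r × Fin s) => Y (φ k) w (ρ k a.1) (κ k a.2))
        atTop id (fun k => P (φ k)) (standardGaussianMatrix r s)

/-- The Kolmogorov distance `sup_x |μ((-∞, x]) - ν((-∞, x])|` of two probability measures on `ℝ`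
(the supremum is over a set bounded by `1`). -/
noncomputable def kolmogorovDist (μ ν : Measure ℝ) : ℝ :=
  ⨆ x : ℝ, |μ.real (Set.Iic x) - ν.real (Set.Iic x)|

/-! Every linear form in the entries of `U Ω` is a linear form `W = ∑ u k * ξ k` in independent
standardized Bernoulli variables `ξ k`. Both assertions are statements about such sums.

The quantitative bound is Stein's method. For `f = steinSolution z`, the expectation of `f'(W) - W
f(W)` is `P(W ≤ z) - Φ(z)`. Since each `ξ k` takes two values, `E[u k * ξ k * f(W)]` is exactly the
expected increment of `f` across those values (`integral_mul_comp_bernoulliSum`). When `∑ u k ^ 2 =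
1`, comparing increments with `u k ^ 2 * f'(W)` leaves an error of order `∑ |u k| ^ 3`, plus the
probability that `W` lies close to `z`, where `f'` jumps. That probability is controlled by the same
identity applied to a truncated linear function (`measureReal_bernoulliSum_mem_Icc_le`).

Convergence of blocks uses characteristic functions. Orthonormal rows make the squared coefficients
of a linear form in a block sum to `∑ t b ^ 2` (`sum_blockCoeff_sq`), while each coefficient is `O(ε
n)`. A second order Taylor expansion of every factor then gives the Gaussian limit
(`exists_norm_prod_sub_exp_le`). -/

/-! ### Gaussian density, distribution function and tails. -/

/-- The standard Gaussian distribution function. -/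
noncomputable def gaussianCDF (x : ℝ) : ℝ := (gaussianReal 0 1).real (Set.Iic x)

/-- The standard Gaussian density. -/
noncomputable def gaussianDensity (x : ℝ) : ℝ := gaussianPDFReal 0 1 x

lemma gaussianDensity_eq (x : ℝ) :
    gaussianDensity x = (√(2 * Real.pi))⁻¹ * Real.exp (-x ^ 2 / 2) := by
  simp [gaussianDensity, gaussianPDFReal]

lemma gaussianDensity_pos (x : ℝ) : 0 < gaussianDensity x :=
  gaussianPDFReal_pos _ _ _ one_ne_zero

lemma gaussianDensity_neg (x : ℝ) : gaussianDensity (-x) = gaussianDensity x := by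
  simp [gaussianDensity_eq]

lemma hasDerivAt_gaussianDensity (x : ℝ) :
    HasDerivAt gaussianDensity (-x * gaussianDensity x) x := by
  have h : HasDerivAt (fun x : ℝ => -x ^ 2 / 2) (-x) x := by
    have := ((hasDerivAt_pow 2 x).neg.div_const 2)
    convert! this using 1
    simp
    ring
  have := (h.exp.const_mul ((√(2 * Real.pi))⁻¹))
  convert! this using 1
  · ext y; rw [gaussianDensity_eq]
  · rw [gaussianDensity_eq]; ring

lemma continuous_gaussianDensity : Continuous gaussianDensity :=
  continuous_iff_continuousAt.2 fun x => (hasDerivAt_gaussianDensity x).continuousAt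

lemma integrable_gaussianDensity : Integrable gaussianDensity :=
  integrable_gaussianPDFReal 0 1

lemma gaussianCDF_eq_integral (x : ℝ) :
    gaussianCDF x = ∫ y in Set.Iic x, gaussianDensity y := by
  rw [gaussianCDF, measureReal_def, gaussianReal_apply_eq_integral _ one_ne_zero,
    ENNReal.toReal_ofReal]
  · rfl
  · exact integral_nonneg fun y => (gaussianDensity_pos y).le

lemma gaussianCDF_nonneg (x : ℝ) : 0 ≤ gaussianCDF x := measureReal_nonneg

lemma gaussianCDF_le_one (x : ℝ) : gaussianCDF x ≤ 1 := measureReal_le_one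

lemma gaussianCDF_mono : Monotone gaussianCDF := fun _ _ h =>
  measureReal_mono (Set.Iic_subset_Iic.2 h)

lemma hasDerivAt_gaussianCDF (x : ℝ) : HasDerivAt gaussianCDF (gaussianDensity x) x := by
  have h : ∀ y, gaussianCDF y = (∫ t in (0 : ℝ)..y, gaussianDensity t) + gaussianCDF 0 := by
    intro y
    rw [gaussianCDF_eq_integral, gaussianCDF_eq_integral,
      ← intervalIntegral.integral_Iic_sub_Iic integrable_gaussianDensity.integrableOn
        integrable_gaussianDensity.integrableOn]
    ring
  rw [funext h]
  exact (continuous_gaussianDensity.integral_hasStrictDerivAt 0 x).hasDerivAt.add_const _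

lemma continuous_gaussianCDF : Continuous gaussianCDF :=
  continuous_iff_continuousAt.2 fun x => (hasDerivAt_gaussianCDF x).continuousAt

lemma one_sub_gaussianCDF (x : ℝ) :
    1 - gaussianCDF x = ∫ y in Set.Ioi x, gaussianDensity y := by
  have h1 : ∫ y, gaussianDensity y = 1 := integral_gaussianPDFReal_eq_one 0 one_ne_zero
  rw [gaussianCDF_eq_integral, ← h1, ← Set.compl_Iic,
    ← integral_add_compl (measurableSet_Iic (a := x)) integrable_gaussianDensity]
  ring

lemma gaussianCDF_neg (x : ℝ) : gaussianCDF (-x) = 1 - gaussianCDF x := by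
  rw [one_sub_gaussianCDF, gaussianCDF_eq_integral, ← integral_comp_neg_Ioi]
  simp [gaussianDensity_neg]

lemma tendsto_gaussianDensity_atTop : Tendsto gaussianDensity atTop (𝓝 0) := by
  have h : Tendsto (fun x : ℝ => x ^ 2 / 2) atTop atTop :=
    (tendsto_pow_atTop two_ne_zero).atTop_div_const two_pos
  have := (Real.tendsto_exp_neg_atTop_nhds_zero.comp h).const_mul ((√(2 * Real.pi))⁻¹)
  rw [mul_zero] at this
  refine this.congr fun x => ?_
  rw [gaussianDensity_eq]; simp [neg_div]

/-- The Gaussian tail bound `x (1 - Φ(x)) ≤ φ(x)`. -/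
lemma mul_one_sub_gaussianCDF_le (x : ℝ) :
    x * (1 - gaussianCDF x) ≤ gaussianDensity x := by
  rcases le_or_gt x 0 with hx | hx
  · have := gaussianCDF_le_one x
    have := gaussianDensity_pos x
    nlinarith
  have hd : ∀ y ∈ Set.Ioi x,
      HasDerivAt (fun y => -gaussianDensity y) (y * gaussianDensity y) y := fun y _ => by
    convert! (hasDerivAt_gaussianDensity y).neg using 1; ring
  have hc : ContinuousWithinAt (fun y => -gaussianDensity y) (Set.Ici x) x :=
    continuous_gaussianDensity.neg.continuousWithinAt
  have hnn : ∀ y ∈ Set.Ioi x, 0 ≤ y * gaussianDensity y := fun y hy =>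
    mul_nonneg (hx.trans hy).le (gaussianDensity_pos y).le
  have ht : Tendsto (fun y => -gaussianDensity y) atTop (𝓝 0) := by
    simpa using tendsto_gaussianDensity_atTop.neg
  have hint := integrableOn_Ioi_deriv_of_nonneg hc hd hnn ht
  have heq := integral_Ioi_of_hasDerivAt_of_nonneg hc hd hnn ht
  rw [one_sub_gaussianCDF, ← integral_const_mul]
  calc _ ≤ ∫ y in Set.Ioi x, y * gaussianDensity y := by
        refine setIntegral_mono_on (integrable_gaussianDensity.integrableOn.const_mul x) hint
          measurableSet_Ioi fun y hy => ?_
        exact mul_le_mul_of_nonneg_right (le_of_lt hy) (gaussianDensity_pos y).le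
    _ = gaussianDensity x := by rw [heq]; ring

lemma gaussianDensity_le_of_abs_le {x y : ℝ} (h : |x| ≤ |y|) :
    gaussianDensity y ≤ gaussianDensity x := by
  rw [gaussianDensity_eq, gaussianDensity_eq]
  have := sq_le_sq.2 h
  gcongr

lemma gaussianDensity_le_one (x : ℝ) : gaussianDensity x ≤ 1 := by
  rw [gaussianDensity_eq]
  have h1 : Real.exp (-x ^ 2 / 2) ≤ 1 := Real.exp_le_one_iff.2 (by nlinarith [sq_nonneg x])
  have h2 : (√(2 * Real.pi))⁻¹ ≤ 1 := by
    refine inv_le_one_of_one_le₀ (Real.one_le_sqrt.2 ?_)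
    linarith [Real.pi_gt_three]
  exact mul_le_one₀ h2 (Real.exp_pos _).le h1

/-- On `[0, 1]` the density is at least its value at `1` and the tail is at most `1`; beyond `1` the
bound `x (1 - Φ(x)) ≤ φ(x)` takes over. -/
lemma one_sub_gaussianCDF_le {x : ℝ} (hx : 0 ≤ x) :
    1 - gaussianCDF x ≤ (gaussianDensity 1)⁻¹ * gaussianDensity x := by
  have hp := gaussianDensity_pos 1
  rw [inv_mul_eq_div, le_div_iff₀ hp]
  have h0 := gaussianCDF_nonneg x
  have h1 := gaussianCDF_le_one x
  rcases le_or_gt x 1 with h | h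
  · have : gaussianDensity 1 ≤ gaussianDensity x :=
      gaussianDensity_le_of_abs_le (by rwa [abs_one, abs_of_nonneg hx])
    nlinarith
  · have := mul_one_sub_gaussianCDF_le x
    have := gaussianDensity_le_one 1
    nlinarith

/-! ### Stein's equation for half-lines. -/

/-- The solution of Stein's equation `f'(w) - w f(w) = 1_{w ≤ z} - Φ(z)`. -/
noncomputable def steinSolution (z w : ℝ) : ℝ :=
  gaussianCDF (min w z) * (1 - gaussianCDF (max w z)) / gaussianDensity w

lemma steinSolution_nonneg (z w : ℝ) : 0 ≤ steinSolution z w :=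
  div_nonneg (mul_nonneg (gaussianCDF_nonneg _) (by linarith [gaussianCDF_le_one (max w z)]))
    (gaussianDensity_pos w).le

lemma steinSolution_le_upper (z w : ℝ) :
    steinSolution z w ≤ (1 - gaussianCDF w) / gaussianDensity w := by
  unfold steinSolution
  gcongr
  · exact (gaussianDensity_pos w).le
  have h1 := gaussianCDF_le_one (min w z)
  have h2 := gaussianCDF_mono (le_max_left w z)
  have h3 := gaussianCDF_le_one (max w z)
  nlinarith

lemma steinSolution_le_lower (z w : ℝ) :
    steinSolution z w ≤ gaussianCDF w / gaussianDensity w := by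
  unfold steinSolution
  gcongr
  · exact (gaussianDensity_pos w).le
  have h1 := gaussianCDF_nonneg (min w z)
  have h2 := gaussianCDF_mono (min_le_left w z)
  have h3 := gaussianCDF_nonneg (max w z)
  nlinarith

lemma steinSolution_le (z w : ℝ) : steinSolution z w ≤ (gaussianDensity 1)⁻¹ := by
  rcases le_total 0 w with h | h
  · refine (steinSolution_le_upper z w).trans ?_
    rw [div_le_iff₀ (gaussianDensity_pos w)]
    exact one_sub_gaussianCDF_le h
  · refine (steinSolution_le_lower z w).trans ?_
    rw [div_le_iff₀ (gaussianDensity_pos w)]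
    have := one_sub_gaussianCDF_le (neg_nonneg.2 h)
    rwa [gaussianCDF_neg, gaussianDensity_neg, sub_sub_cancel] at this

lemma abs_steinSolution_le (z w : ℝ) : |steinSolution z w| ≤ (gaussianDensity 1)⁻¹ := by
  rw [abs_of_nonneg (steinSolution_nonneg z w)]; exact steinSolution_le z w

/-- The Gaussian tail bound at `|w|`, applied to the upper or the lower tail according to the sign
of `w`. -/
lemma abs_mul_steinSolution_le (z w : ℝ) : |w * steinSolution z w| ≤ 1 := by
  rw [abs_mul, abs_of_nonneg (steinSolution_nonneg z w)]
  have hd := gaussianDensity_pos w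
  rcases le_total 0 w with h | h
  · rw [abs_of_nonneg h]
    refine (mul_le_mul_of_nonneg_left (steinSolution_le_upper z w) h).trans ?_
    rw [mul_div_assoc', div_le_one hd]
    exact mul_one_sub_gaussianCDF_le w
  · rw [abs_of_nonpos h]
    refine (mul_le_mul_of_nonneg_left (steinSolution_le_lower z w) (neg_nonneg.2 h)).trans ?_
    rw [mul_div_assoc', div_le_one hd]
    have := mul_one_sub_gaussianCDF_le (-w)
    rwa [gaussianCDF_neg, gaussianDensity_neg, sub_sub_cancel] at this

lemma continuous_steinSolution (z : ℝ) : Continuous (steinSolution z) := by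
  unfold steinSolution
  refine Continuous.div ?_ continuous_gaussianDensity fun w => (gaussianDensity_pos w).ne'
  exact (continuous_gaussianCDF.comp (by fun_prop)).mul
    (continuous_const.sub (continuous_gaussianCDF.comp (by fun_prop)))

/-- The solution has a kink at `z`, so only right derivatives are taken; at `w = z` the branch to
the right applies, hence the strict inequality. Right derivatives suffice for the mean value
inequality. -/
lemma hasDerivWithinAt_steinSolution (z w : ℝ) :
    HasDerivWithinAt (steinSolution z)
      (w * steinSolution z w + (if w < z then 1 else 0) - gaussianCDF z) (Set.Ici w) w := by
  have hd := (gaussianDensity_pos w).ne'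
  split_ifs with h
  · have h1 : HasDerivAt (fun x => gaussianCDF x * (1 - gaussianCDF z) / gaussianDensity x)
        (w * steinSolution z w + 1 - gaussianCDF z) w := by
      convert! ((hasDerivAt_gaussianCDF w).mul_const (1 - gaussianCDF z)).div
        (hasDerivAt_gaussianDensity w) hd using 1
      rw [steinSolution, min_eq_left h.le, max_eq_right h.le]
      field_simp
      ring
    refine (h1.congr_of_eventuallyEq ?_).hasDerivWithinAt
    filter_upwards [Iio_mem_nhds h] with x hx
    rw [steinSolution, min_eq_left (le_of_lt hx), max_eq_right (le_of_lt hx)]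
  · have h := not_lt.1 h
    have h1 : HasDerivAt (fun x => gaussianCDF z * (1 - gaussianCDF x) / gaussianDensity x)
        (w * steinSolution z w + 0 - gaussianCDF z) w := by
      convert! (((hasDerivAt_gaussianCDF w).const_sub 1).const_mul (gaussianCDF z)).div
        (hasDerivAt_gaussianDensity w) hd using 1
      rw [steinSolution, min_eq_right h, max_eq_left h]
      field_simp
      ring
    refine h1.hasDerivWithinAt.congr (fun x hx => ?_) ?_
    · rw [steinSolution, min_eq_right (h.trans hx), max_eq_left (h.trans hx)]
    · rw [steinSolution, min_eq_right h, max_eq_left h]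

/-- In Stein's equation both `w f(w)` and `1_{w < z} - Φ(z)` lie in `[-1, 1]`, so the slope is at
most `2`. -/
lemma abs_steinSolution_sub_le (z x y : ℝ) :
    |steinSolution z y - steinSolution z x| ≤ 2 * |y - x| := by
  wlog hxy : x ≤ y generalizing x y
  · rw [abs_sub_comm, abs_sub_comm y]; exact this y x (le_of_not_ge hxy)
  rw [abs_of_nonneg (sub_nonneg.2 hxy)]
  refine norm_image_sub_le_of_norm_deriv_right_le_segment
    (continuous_steinSolution z).continuousOn
    (fun w _ => hasDerivWithinAt_steinSolution z w) (fun w _ => ?_) y ⟨hxy, le_rfl⟩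
  have h1 := abs_le.1 (abs_mul_steinSolution_le z w)
  have h2 := gaussianCDF_nonneg z
  have h3 := gaussianCDF_le_one z
  rw [Real.norm_eq_abs, abs_le]
  split_ifs <;> constructor <;> linarith

lemma abs_mul_steinSolution_sub_le (z w t : ℝ) :
    |t * steinSolution z t - w * steinSolution z w| ≤
      (2 * |w| + (gaussianDensity 1)⁻¹) * |t - w| := by
  have h : t * steinSolution z t - w * steinSolution z w =
      w * (steinSolution z t - steinSolution z w) + (t - w) * steinSolution z t := by ring
  rw [h]
  refine (abs_add_le _ _).trans ?_
  rw [abs_mul, abs_mul]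
  have h1 := mul_le_mul_of_nonneg_left (abs_steinSolution_sub_le z w t) (abs_nonneg w)
  have h2 := mul_le_mul_of_nonneg_left (abs_steinSolution_le z t) (abs_nonneg (t - w))
  linarith

/-- First order expansion of the Stein solution, the derivative being expressed by means of
Stein's equation. -/
lemma abs_steinSolution_sub_sub_le (z w t : ℝ) :
    |steinSolution z t - steinSolution z w -
        (t - w) * (w * steinSolution z w + (if w ≤ z then 1 else 0) - gaussianCDF z)| ≤
      |t - w| * ((2 * |w| + (gaussianDensity 1)⁻¹) * |t - w| +
        if |w - z| ≤ |t - w| then 1 else 0) := by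
  set L := w * steinSolution z w + (if w ≤ z then 1 else 0) - gaussianCDF z with hL
  set M := (2 * |w| + (gaussianDensity 1)⁻¹) * |t - w| + (if |w - z| ≤ |t - w| then 1 else 0)
    with hM
  have hK : 0 ≤ 2 * |w| + (gaussianDensity 1)⁻¹ := by
    have := inv_pos.2 (gaussianDensity_pos 1); positivity
  -- The mean value inequality will be applied to `f(x) - x L`. Its slope varies through `x f(x)`,
  -- which is locally Lipschitz, and through the indicator, which can change only if `z` is within
  -- `|t - w|` of `w`.
  have key : ∀ x ∈ Set.Ico (min w t) (max w t),
      ‖x * steinSolution z x + (if x < z then 1 else 0) - gaussianCDF z - L‖ ≤ M := by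
    intro x hx
    have hxw : |x - w| ≤ |t - w| := by
      obtain ⟨h1, h2⟩ := hx
      rcases le_total w t with h | h
      · rw [min_eq_left h] at h1; rw [max_eq_right h] at h2
        rw [abs_of_nonneg (by linarith), abs_of_nonneg (by linarith)]; linarith
      · rw [min_eq_right h] at h1; rw [max_eq_left h] at h2
        rw [abs_of_nonpos (by linarith), abs_of_nonpos (by linarith)]; linarith
    have h1 : |x * steinSolution z x - w * steinSolution z w| ≤
        (2 * |w| + (gaussianDensity 1)⁻¹) * |t - w| :=
      (abs_mul_steinSolution_sub_le z w x).trans (mul_le_mul_of_nonneg_left hxw hK)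
    have h2 : |(if x < z then (1 : ℝ) else 0) - (if w ≤ z then 1 else 0)| ≤
        if |w - z| ≤ |t - w| then 1 else 0 := by
      by_cases hz : |w - z| ≤ |t - w|
      · rw [if_pos hz]; split_ifs <;> simp
      · rw [if_neg hz]
        have : ¬ |w - z| ≤ |x - w| := fun h => hz (h.trans hxw)
        have hiff : x < z ↔ w ≤ z := by
          constructor <;> intro h <;> by_contra hc <;> apply this
          · rw [abs_of_nonneg (by linarith), abs_of_nonpos (by linarith)]; linarith
          · rw [abs_of_nonpos (by linarith), abs_of_nonneg (by linarith)]; linarith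
        simp [hiff]
    have h3 : x * steinSolution z x + (if x < z then 1 else 0) - gaussianCDF z - L =
        (x * steinSolution z x - w * steinSolution z w) +
          ((if x < z then (1 : ℝ) else 0) - (if w ≤ z then 1 else 0)) := by rw [hL]; ring
    rw [h3]
    exact (norm_add_le _ _).trans (add_le_add h1 h2)
  have main := norm_image_sub_le_of_norm_deriv_right_le_segment
    (f := fun x => steinSolution z x - x * L) (a := min w t) (b := max w t)
    ((continuous_steinSolution z).sub (continuous_id.mul continuous_const)).continuousOn
    (fun x _ => (hasDerivWithinAt_steinSolution z x).sub
      (by simpa using (hasDerivWithinAt_id x (Set.Ici x)).mul_const L)) key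
    (max w t) ⟨min_le_max, le_rfl⟩
  rw [Real.norm_eq_abs] at main
  rcases le_total w t with h | h
  · rw [min_eq_left h, max_eq_right h] at main
    rw [abs_of_nonneg (sub_nonneg.2 h)] at hM ⊢
    convert! main using 1
    · congr 1; ring
    · ring
  · rw [min_eq_right h, max_eq_left h, abs_sub_comm] at main
    rw [abs_of_nonpos (sub_nonpos.2 h)] at hM ⊢
    convert! main using 1
    · congr 1; ring
    · ring

/-! ### Standardized Bernoulli variables and their sums. -/

/-- The standard deviation of a Bernoulli variable. -/
noncomputable def bernoulliStd (p : unitInterval) : ℝ := √((p : ℝ) * (1 - (p : ℝ)))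

/-- The affine map that standardizes a Bernoulli variable. -/
noncomputable def bernoulliStandardize (p : unitInterval) (x : ℝ) : ℝ :=
  (x - (p : ℝ)) / bernoulliStd p

/-- A linear combination of standardized Bernoulli variables. -/
noncomputable def bernoulliSum {S ι : Type*} [Fintype ι] (p : unitInterval) (u : ι → ℝ)
    (X : ι → S → ℝ) (w : S) : ℝ :=
  ∑ k, u k * bernoulliStandardize p (X k w)

lemma bernoulliStd_pos {p : unitInterval} (hp0 : 0 < p) (hp1 : p < 1) : 0 < bernoulliStd p := by
  have h0 : (0 : ℝ) < p := hp0
  have h1 : (p : ℝ) < 1 := hp1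
  exact Real.sqrt_pos.2 (mul_pos h0 (sub_pos.2 h1))

lemma bernoulliStd_sq (p : unitInterval) :
    bernoulliStd p ^ 2 = (p : ℝ) * (1 - (p : ℝ)) :=
  Real.sq_sqrt (mul_nonneg p.2.1 (sub_nonneg.2 p.2.2))

lemma measurable_bernoulliStandardize (p : unitInterval) :
    Measurable (bernoulliStandardize p) := by
  unfold bernoulliStandardize; fun_prop

section Integrals

variable {p : unitInterval}

lemma integral_bernoulliStandardize :
    ∫ x, bernoulliStandardize p x ∂(bernoulliMeasure (1 : ℝ) 0 p) = 0 := by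
  rw [integral_bernoulliMeasure]
  simp [bernoulliStandardize]
  ring

lemma integral_bernoulliStandardize_sq (hp0 : 0 < p) (hp1 : p < 1) :
    ∫ x, bernoulliStandardize p x ^ 2 ∂(bernoulliMeasure (1 : ℝ) 0 p) = 1 := by
  have hs := (bernoulliStd_pos hp0 hp1).ne'
  have h2 := bernoulliStd_sq p
  rw [integral_bernoulliMeasure]
  simp only [bernoulliStandardize, smul_eq_mul, div_pow, h2]
  rw [h2.symm]
  field_simp
  simp
  rw [h2]
  ring

lemma ae_eq_one_or_zero_bernoulliMeasure :
    ∀ᵐ x ∂(bernoulliMeasure (1 : ℝ) 0 p), x = 1 ∨ x = 0 := by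
  rw [bernoulliMeasure_def]
  refine ae_add_measure_iff.2 ⟨?_, ?_⟩ <;>
  · refine Measure.ae_smul_measure ?_ _
    rw [ae_dirac_eq]
    simp

end Integrals

lemma integral_indicator_const_of_nullMeasurableSet {S : Type*} [MeasurableSpace S] {P : Measure S}
    {E : Set S} (hE : NullMeasurableSet E P) (c : ℝ) :
    ∫ w, E.indicator (fun _ => c) w ∂P = P.real E * c := by
  rw [integral_indicator₀ hE, setIntegral_const, smul_eq_mul]

/-! ### Increments in one Bernoulli variable. -/

/-- The `k`-th summand of a linear combination of standardized Bernoulli variables is removed. -/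
noncomputable def bernoulliSumErase {S ι : Type*} [Fintype ι] (p : unitInterval) (u : ι → ℝ)
    (X : ι → S → ℝ) (k : ι) (w : S) : ℝ :=
  bernoulliSum p u X w - u k * bernoulliStandardize p (X k w)

/-- The increment of `g` when the `k`-th Bernoulli variable passes from `0` to `1`, the others being
fixed, with the weight that makes it integrate to the `k`-th part of `W g(W)`. -/
noncomputable def steinIncrement {S ι : Type*} [Fintype ι] (p : unitInterval) (u : ι → ℝ)
    (X : ι → S → ℝ) (g : ℝ → ℝ) (k : ι) (w : S) : ℝ :=
  u k * bernoulliStd p * (g (bernoulliSumErase p u X k w + u k * bernoulliStandardize p 1) -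
    g (bernoulliSumErase p u X k w + u k * bernoulliStandardize p 0))

section Deterministic

variable {S ι : Type*} [Fintype ι] {p : unitInterval} {X : ι → S → ℝ}

lemma standardize_one_sub_zero :
    bernoulliStandardize p 1 - bernoulliStandardize p 0 = (bernoulliStd p)⁻¹ := by
  simp [bernoulliStandardize]; ring

/-- The current value of the sum is one endpoint of the increment and the other is at distance `|u
k| / bernoulliStd p`. The weight times this step is `u k ^ 2` up to sign, so the first order
expansion of the Stein solution applies. -/
lemma abs_steinIncrement_sub_le (hp0 : 0 < p) (hp1 : p < 1) (u : ι → ℝ) (z : ℝ) (k : ι) {w : S}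
    (hw : X k w = 1 ∨ X k w = 0) :
    |steinIncrement p u X (steinSolution z) k w - u k ^ 2 *
        (bernoulliSum p u X w * steinSolution z (bernoulliSum p u X w) +
          (if bernoulliSum p u X w ≤ z then 1 else 0) - gaussianCDF z)| ≤
      u k ^ 2 * ((2 * |bernoulliSum p u X w| + (gaussianDensity 1)⁻¹) *
        (|u k| / bernoulliStd p) +
        if |bernoulliSum p u X w - z| ≤ |u k| / bernoulliStd p then 1 else 0) := by
  have hs := bernoulliStd_pos hp0 hp1
  have hd := standardize_one_sub_zero (p := p)
  have hW : bernoulliSum p u X w =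
      bernoulliSumErase p u X k w + u k * bernoulliStandardize p (X k w) := by
    rw [bernoulliSumErase]; ring
  set W := bernoulliSum p u X w
  have hsq : u k ^ 2 = |u k * bernoulliStd p| * (|u k| / bernoulliStd p) := by
    rw [abs_mul, abs_of_pos hs]; field_simp; rw [sq_abs]
  rcases hw with h | h
  · have hV : bernoulliSumErase p u X k w + u k * bernoulliStandardize p 1 = W := by
      rw [hW, h]
    have hV' : bernoulliSumErase p u X k w + u k * bernoulliStandardize p 0 =
        W - u k / bernoulliStd p := by
      rw [← hV, div_eq_mul_inv, ← hd]; ring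
    have key := abs_steinSolution_sub_sub_le z W (W - u k / bernoulliStd p)
    rw [steinIncrement, hV, hV']
    rw [show W - u k / bernoulliStd p - W = -(u k / bernoulliStd p) by ring, abs_neg, abs_div,
      abs_of_pos hs] at key
    conv_rhs => rw [hsq, mul_assoc]
    refine le_trans (le_of_eq ?_) (mul_le_mul_of_nonneg_left key (abs_nonneg _))
    rw [← abs_mul, ← abs_neg]
    congr 1
    field_simp
    ring
  · have hV : bernoulliSumErase p u X k w + u k * bernoulliStandardize p 0 = W := by
      rw [hW, h]
    have hV' : bernoulliSumErase p u X k w + u k * bernoulliStandardize p 1 =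
        W + u k / bernoulliStd p := by
      rw [← hV, div_eq_mul_inv, ← hd]; ring
    have key := abs_steinSolution_sub_sub_le z W (W + u k / bernoulliStd p)
    rw [steinIncrement, hV, hV']
    rw [show W + u k / bernoulliStd p - W = u k / bernoulliStd p by ring, abs_div,
      abs_of_pos hs] at key
    conv_rhs => rw [hsq, mul_assoc]
    refine le_trans (le_of_eq ?_) (mul_le_mul_of_nonneg_left key (abs_nonneg _))
    rw [← abs_mul]
    congr 1
    field_simp

lemma steinIncrement_nonneg_of_monotone (hp0 : 0 < p) (hp1 : p < 1) (u : ι → ℝ) {g : ℝ → ℝ}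
    (hg : Monotone g) (k : ι) (w : S) : 0 ≤ steinIncrement p u X g k w := by
  have hs := bernoulliStd_pos hp0 hp1
  have hd : bernoulliStandardize p 0 ≤ bernoulliStandardize p 1 := by
    have := standardize_one_sub_zero (p := p)
    have := inv_pos.2 hs
    linarith
  unfold steinIncrement
  rcases le_total 0 (u k) with h | h
  · exact mul_nonneg (mul_nonneg h hs.le)
      (sub_nonneg.2 (hg (by have := mul_le_mul_of_nonneg_left hd h; linarith)))
  · exact mul_nonneg_of_nonpos_of_nonpos (mul_nonpos_of_nonpos_of_nonneg h hs.le)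
      (sub_nonpos.2 (hg (by have := mul_le_mul_of_nonpos_left hd h; linarith)))

/-- If `g` has slope one near the value of the sum, then the increment is `u k ^ 2`. -/
lemma steinIncrement_eq_sq (hp0 : 0 < p) (hp1 : p < 1) (u : ι → ℝ) {g : ℝ → ℝ} (k : ι) {w : S}
    (hw : X k w = 1 ∨ X k w = 0) {m : ℝ}
    (hg : ∀ x, |x - bernoulliSum p u X w| ≤ |u k| / bernoulliStd p → g x = x - m) :
    steinIncrement p u X g k w = u k ^ 2 := by
  have hs := bernoulliStd_pos hp0 hp1
  have hd := standardize_one_sub_zero (p := p)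
  have hW : bernoulliSum p u X w =
      bernoulliSumErase p u X k w + u k * bernoulliStandardize p (X k w) := by
    rw [bernoulliSumErase]; ring
  have hb : |u k * (bernoulliStandardize p 1 - bernoulliStandardize p 0)| ≤
      |u k| / bernoulliStd p := by
    rw [hd, abs_mul, abs_of_pos (inv_pos.2 hs), div_eq_mul_inv]
  have h0 : 0 ≤ |u k| / bernoulliStd p := by positivity
  have h1 : g (bernoulliSumErase p u X k w + u k * bernoulliStandardize p 1) =
      bernoulliSumErase p u X k w + u k * bernoulliStandardize p 1 - m := by
    apply hg
    rcases hw with h | h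
    · rw [hW, h]; simpa using h0
    · rw [hW, h]; convert! hb using 2; ring
  have h2 : g (bernoulliSumErase p u X k w + u k * bernoulliStandardize p 0) =
      bernoulliSumErase p u X k w + u k * bernoulliStandardize p 0 - m := by
    apply hg
    rcases hw with h | h
    · rw [hW, h, ← abs_neg]; convert! hb using 2; ring
    · rw [hW, h]; simpa using h0
  rw [steinIncrement, h1, h2]
  have : bernoulliStandardize p 1 = bernoulliStandardize p 0 + (bernoulliStd p)⁻¹ := by linarith
  rw [this]
  field_simp
  ring

lemma sum_abs_pow_three_pos {ι : Type*} [Fintype ι] {u : ι → ℝ} (hu : ∑ k, u k ^ 2 = 1) : 0 < ∑ k, |u k| ^ 3 := by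
  by_contra h
  have h0 := (Finset.sum_eq_zero_iff_of_nonneg fun k _ => by positivity).1
    (le_antisymm (not_lt.1 h) (Finset.sum_nonneg fun k _ => by positivity : _ ≤ ∑ k, |u k| ^ 3))
  have : ∑ k, u k ^ 2 = 0 := Finset.sum_eq_zero fun k hk => by
    have := h0 k hk
    simp_all
  linarith

end Deterministic

/-! ### Stein identity, concentration and Berry–Esseen bound. -/

section BernoulliSum

variable {S ι : Type*} [MeasurableSpace S] {P : Measure S} [Fintype ι]
  {p : unitInterval} {X : ι → S → ℝ}

lemma ae_eq_one_or_zero {Y : S → ℝ} (law : HasLaw Y (bernoulliMeasure (1 : ℝ) 0 p) P) :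
    ∀ᵐ w ∂P, Y w = 1 ∨ Y w = 0 :=
  ae_of_ae_map (p := fun x => x = 1 ∨ x = 0) law.aemeasurable
    (law.map_eq ▸ ae_eq_one_or_zero_bernoulliMeasure)

lemma aemeasurable_bernoulliSum (law : ∀ k, HasLaw (X k) (bernoulliMeasure (1 : ℝ) 0 p) P)
    (u : ι → ℝ) : AEMeasurable (bernoulliSum p u X) P := by
  unfold bernoulliSum
  exact Finset.aemeasurable_fun_sum _ fun k _ =>
    ((measurable_bernoulliStandardize p).comp_aemeasurable (law k).aemeasurable).const_mul _

lemma aemeasurable_bernoulliSumErase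
    (law : ∀ k, HasLaw (X k) (bernoulliMeasure (1 : ℝ) 0 p) P) (u : ι → ℝ) (k : ι) :
    AEMeasurable (bernoulliSumErase p u X k) P :=
  (aemeasurable_bernoulliSum law u).sub
    (((measurable_bernoulliStandardize p).comp_aemeasurable (law k).aemeasurable).const_mul _)

lemma indepFun_bernoulliSumErase (indep : iIndepFun X P)
    (law : ∀ k, HasLaw (X k) (bernoulliMeasure (1 : ℝ) 0 p) P) (u : ι → ℝ) (k : ι) :
    IndepFun (X k) (bernoulliSumErase p u X k) P := by
  classical
  -- Leaving the `k`-th variable unscaled gives independence from `X k` itself, even when `u k = 0`.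
  let h : ι → ℝ → ℝ := fun j => if j = k then id else fun x => u j * bernoulliStandardize p x
  have hh : ∀ j, Measurable (h j) := fun j => by
    by_cases hj : j = k
    · simp only [h, if_pos hj]; exact measurable_id
    · simp only [h, if_neg hj]; exact (measurable_bernoulliStandardize p).const_mul _
  have h1 := (indep.comp h hh).indepFun_finsetSum_of_notMem₀
    (fun j => (hh j).comp_aemeasurable (law j).aemeasurable)
    (Finset.notMem_erase k Finset.univ)
  convert! h1.symm using 1
  · simp [h]
  · ext w
    rw [bernoulliSumErase, bernoulliSum, Finset.sum_apply,
      ← Finset.add_sum_erase _ _ (Finset.mem_univ k), add_sub_cancel_left]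
    refine Finset.sum_congr rfl fun j hj => ?_
    simp [h, Finset.ne_of_mem_erase hj]

lemma integrable_mul_comp_bernoulliSum
    (law : ∀ k, HasLaw (X k) (bernoulliMeasure (1 : ℝ) 0 p) P) (u : ι → ℝ) {Y : S → ℝ}
    (hY : Integrable Y P) {g : ℝ → ℝ} (hg : Measurable g) {M : ℝ} (hM : ∀ x, |g x| ≤ M) :
    Integrable (fun w => Y w * g (bernoulliSum p u X w)) P :=
  hY.mul_bdd (c := M) (hg.comp_aemeasurable (aemeasurable_bernoulliSum law u)).aestronglyMeasurable
    (ae_of_all _ fun _ => hM _)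

variable [IsProbabilityMeasure P]

lemma memLp_bernoulliStandardize {Y : S → ℝ} (law : HasLaw Y (bernoulliMeasure (1 : ℝ) 0 p) P) :
    MemLp (fun w => bernoulliStandardize p (Y w)) 2 P := by
  refine MemLp.of_bound ((measurable_bernoulliStandardize p).comp_aemeasurable
    law.aemeasurable).aestronglyMeasurable
    (max |bernoulliStandardize p 1| |bernoulliStandardize p 0|) ?_
  filter_upwards [ae_eq_one_or_zero law] with w hw
  rcases hw with h | h <;> simp [h]

lemma memLp_bernoulliSum (law : ∀ k, HasLaw (X k) (bernoulliMeasure (1 : ℝ) 0 p) P)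
    (u : ι → ℝ) : MemLp (bernoulliSum p u X) 2 P := by
  unfold bernoulliSum
  exact memLp_finsetSum _ fun k _ => (memLp_bernoulliStandardize (law k)).const_mul _

lemma integrable_comp_aemeasurable {Y : S → ℝ} (hY : AEMeasurable Y P) {g : ℝ → ℝ}
    (hg : Measurable g) {M : ℝ} (hM : ∀ x, |g x| ≤ M) : Integrable (fun w => g (Y w)) P :=
  Integrable.of_bound (hg.comp_aemeasurable hY).aestronglyMeasurable M
    (ae_of_all _ fun _ => hM _)

lemma integrable_steinIncrement (law : ∀ k, HasLaw (X k) (bernoulliMeasure (1 : ℝ) 0 p) P)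
    (u : ι → ℝ) {g : ℝ → ℝ} (hg : Measurable g) {M : ℝ} (hM : ∀ x, |g x| ≤ M) (k : ι) :
    Integrable (steinIncrement p u X g k) P := by
  have h := aemeasurable_bernoulliSumErase law u k
  exact ((integrable_comp_aemeasurable (h.add_const _) hg hM).sub
    (integrable_comp_aemeasurable (h.add_const _) hg hM)).const_mul _

/-- A discrete integration by parts: averaging over `X k` with the remaining sum frozen gives the
factor `p (1 - p) / bernoulliStd p = bernoulliStd p` in front of the increment. -/
lemma integral_mul_comp_bernoulliSum (hp0 : 0 < p) (hp1 : p < 1) (indep : iIndepFun X P)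
    (law : ∀ k, HasLaw (X k) (bernoulliMeasure (1 : ℝ) 0 p) P) (u : ι → ℝ) {g : ℝ → ℝ}
    (hg : Measurable g) {M : ℝ} (hM : ∀ x, |g x| ≤ M) (k : ι) :
    ∫ w, u k * bernoulliStandardize p (X k w) * g (bernoulliSum p u X w) ∂P =
      ∫ w, steinIncrement p u X g k w ∂P := by
  have hs := (bernoulliStd_pos hp0 hp1).ne'
  have h2 := bernoulliStd_sq p
  have hV := aemeasurable_bernoulliSumErase law u k
  have hind := indepFun_bernoulliSumErase indep law u k
  set A : S → ℝ := fun w => g (bernoulliSumErase p u X k w + u k * bernoulliStandardize p 1)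
    with hA
  set B : S → ℝ := fun w => g (bernoulliSumErase p u X k w + u k * bernoulliStandardize p 0)
    with hB
  have hAi : Integrable A P := integrable_comp_aemeasurable (hV.add_const _) hg hM
  have hBi : Integrable B P := integrable_comp_aemeasurable (hV.add_const _) hg hM
  have hEX : ∫ w, X k w ∂P = p := by
    rw [(law k).integral_eq, integral_bernoulliMeasure]; simp
  have hXm := (law k).aemeasurable.aestronglyMeasurable
  have hXA : ∫ w, X k w * A w ∂P = p * ∫ w, A w ∂P := by
    rw [← hEX]
    exact (hind.comp measurable_id (ψ := fun v => g (v + u k * bernoulliStandardize p 1))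
      (hg.comp (measurable_id.add_const _))).integral_fun_mul_eq_mul_integral hXm
      hAi.aestronglyMeasurable
  have hXB : ∫ w, X k w * B w ∂P = p * ∫ w, B w ∂P := by
    rw [← hEX]
    exact (hind.comp measurable_id (ψ := fun v => g (v + u k * bernoulliStandardize p 0))
      (hg.comp (measurable_id.add_const _))).integral_fun_mul_eq_mul_integral hXm
      hBi.aestronglyMeasurable
  have hXb : ∀ᵐ w ∂P, ‖X k w‖ ≤ 1 := by
    filter_upwards [ae_eq_one_or_zero (law k)] with w hw
    rcases hw with h | h <;> simp [h]
  have hXAi : Integrable (fun w => X k w * A w) P := hAi.bdd_mul (c := 1) hXm hXb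
  have hXBi : Integrable (fun w => X k w * B w) P := hBi.bdd_mul (c := 1) hXm hXb
  -- As `X k` is `0` or `1`, it acts as an indicator selecting `A` or `B`, both functions of the
  -- erased sum; independence then replaces conditioning.
  have hae : ∀ᵐ w ∂P, u k * bernoulliStandardize p (X k w) * g (bernoulliSum p u X w) =
      u k * (1 - p) / bernoulliStd p * (X k w * A w) -
        (u k * p / bernoulliStd p * B w - u k * p / bernoulliStd p * (X k w * B w)) := by
    filter_upwards [ae_eq_one_or_zero (law k)] with w hw
    have hW : bernoulliSum p u X w =
        bernoulliSumErase p u X k w + u k * bernoulliStandardize p (X k w) := by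
      rw [bernoulliSumErase]; ring
    rcases hw with h | h
    · rw [hW, h]; simp only [hA, hB, bernoulliStandardize]; ring
    · rw [hW, h]; simp only [hA, hB, bernoulliStandardize]; ring
  rw [integral_congr_ae hae, integral_sub (hXAi.const_mul _)
    ((hBi.const_mul _).sub' (hXBi.const_mul _)), integral_sub (hBi.const_mul _) (hXBi.const_mul _),
    integral_const_mul, integral_const_mul, integral_const_mul, hXA, hXB]
  unfold steinIncrement
  rw [integral_const_mul, integral_sub hAi hBi]
  have e1 : bernoulliStd p = p * (1 - p) / bernoulliStd p := by
    rw [eq_div_iff hs, ← h2]; ring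
  conv_rhs => rw [e1]
  ring

lemma integral_bernoulliSum_mul_comp (hp0 : 0 < p) (hp1 : p < 1) (indep : iIndepFun X P)
    (law : ∀ k, HasLaw (X k) (bernoulliMeasure (1 : ℝ) 0 p) P) (u : ι → ℝ) {g : ℝ → ℝ}
    (hg : Measurable g) {M : ℝ} (hM : ∀ x, |g x| ≤ M) :
    ∫ w, bernoulliSum p u X w * g (bernoulliSum p u X w) ∂P =
      ∫ w, ∑ k, steinIncrement p u X g k w ∂P := by
  have e : ∀ w, bernoulliSum p u X w * g (bernoulliSum p u X w) =
      ∑ k, u k * bernoulliStandardize p (X k w) * g (bernoulliSum p u X w) := fun w => by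
    rw [← Finset.sum_mul]; rfl
  simp_rw [e]
  rw [integral_finsetSum _ fun k _ => integrable_mul_comp_bernoulliSum law u
      (((memLp_bernoulliStandardize (law k)).integrable one_le_two).const_mul _) hg hM,
    integral_finsetSum _ fun k _ => integrable_steinIncrement law u hg hM k]
  exact Finset.sum_congr rfl fun k _ => integral_mul_comp_bernoulliSum hp0 hp1 indep law u hg hM k

/-- The sum is centred with variance `∑ u k ^ 2 = 1`, and `|W| ≤ (1 + W ^ 2) / 2`. -/
lemma integral_abs_bernoulliSum_le (hp0 : 0 < p) (hp1 : p < 1) (indep : iIndepFun X P)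
    (law : ∀ k, HasLaw (X k) (bernoulliMeasure (1 : ℝ) 0 p) P) {u : ι → ℝ}
    (hu : ∑ k, u k ^ 2 = 1) : ∫ w, |bernoulliSum p u X w| ∂P ≤ 1 := by
  have hL := memLp_bernoulliSum law u
  have hmean : ∀ k, ∫ w, bernoulliStandardize p (X k w) ∂P = 0 := fun k => by
    rw [← integral_bernoulliStandardize (p := p)]
    exact (law k).integral_comp (measurable_bernoulliStandardize p).aestronglyMeasurable
  have hmean2 : ∀ k, ∫ w, bernoulliStandardize p (X k w) ^ 2 ∂P = 1 := fun k => by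
    rw [← integral_bernoulliStandardize_sq hp0 hp1]
    exact (law k).integral_comp (f := fun x => bernoulliStandardize p x ^ 2)
      ((measurable_bernoulliStandardize p).pow_const 2).aestronglyMeasurable
  have hEW : ∫ w, bernoulliSum p u X w ∂P = 0 := by
    unfold bernoulliSum
    rw [integral_finsetSum _ fun k _ =>
      ((memLp_bernoulliStandardize (law k)).integrable one_le_two).const_mul _]
    simp [integral_const_mul, hmean]
  have hvar : Var[bernoulliSum p u X; P] = 1 := by
    have e : bernoulliSum p u X = ∑ k, fun w => u k * bernoulliStandardize p (X k w) := by
      ext w; simp [bernoulliSum]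
    rw [e, IndepFun.variance_sum
      (fun k _ => (memLp_bernoulliStandardize (law k)).const_mul _)]
    · rw [← hu]
      refine Finset.sum_congr rfl fun k _ => ?_
      rw [variance_const_mul, variance_of_integral_eq_zero
        (memLp_bernoulliStandardize (law k)).aestronglyMeasurable.aemeasurable (hmean k), hmean2,
        mul_one]
    · intro i _ j _ hij
      exact (indep.indepFun hij).comp
        (φ := fun x => u i * bernoulliStandardize p x)
        (ψ := fun x => u j * bernoulliStandardize p x)
        ((measurable_bernoulliStandardize p).const_mul _)
        ((measurable_bernoulliStandardize p).const_mul _)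
  rw [variance_of_integral_eq_zero hL.aestronglyMeasurable.aemeasurable hEW] at hvar
  calc ∫ w, |bernoulliSum p u X w| ∂P
      ≤ ∫ w, (1 / 2 + bernoulliSum p u X w ^ 2 / 2) ∂P := by
        refine integral_mono (hL.integrable one_le_two).abs
          ((integrable_const _).add (hL.integrable_sq.div_const _)) fun w => ?_
        have := sq_nonneg (|bernoulliSum p u X w| - 1)
        rw [← sq_abs (bernoulliSum p u X w)]
        simp only
        linarith
    _ = 1 := by
        rw [integral_add (integrable_const _) (hL.integrable_sq.div_const _), integral_div (f := fun w => bernoulliSum p u X w ^ 2), hvar]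
        simp; norm_num

/-- Concentration inequality for linear combinations of standardized Bernoulli variables. -/
lemma measureReal_bernoulliSum_mem_Icc_le (hp0 : 0 < p) (hp1 : p < 1) (indep : iIndepFun X P)
    (law : ∀ k, HasLaw (X k) (bernoulliMeasure (1 : ℝ) 0 p) P) {u : ι → ℝ}
    (hu : ∑ k, u k ^ 2 = 1) {a b : ℝ} (hab : a ≤ b) :
    P.real {w | bernoulliSum p u X w ∈ Set.Icc a b} ≤
      (b - a) + 4 * (∑ k, |u k| ^ 3) / bernoulliStd p := by
  have hs := bernoulliStd_pos hp0 hp1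
  have hγ := sum_abs_pow_three_pos hu
  set s := bernoulliStd p
  set γ := ∑ k, |u k| ^ 3 with hγdef
  -- Indices with `|u k| ≤ 2 * γ` move the sum by at most `δ`; the others carry at most half of `∑ u
  -- k ^ 2`.
  set δ := 2 * γ / s with hδ
  have hδ0 : 0 < δ := by positivity
  set h := (b - a) / 2 + δ with hh
  have hh0 : 0 < h := by have := sub_nonneg.2 hab; positivity
  set m := (a + b) / 2 with hm
  -- A monotone function of slope one on `[a - δ, b + δ]`, truncated at `± h`: its increments are
  -- nonnegative, while `E[W g(W)] ≤ h`.
  let g : ℝ → ℝ := fun x => max (-h) (min h (x - m))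
  have hgm : Monotone g := fun x y hxy => by
    simp only [g]; gcongr
  have hgM : ∀ x, |g x| ≤ h := fun x => abs_le.2
    ⟨le_max_left _ _, max_le (by linarith) (min_le_left _ _)⟩
  have hgmeas : Measurable g := hgm.measurable
  have hglin : ∀ x, a - δ ≤ x → x ≤ b + δ → g x = x - m := fun x h1 h2 => by
    simp only [g]
    rw [min_eq_right (by linarith), max_eq_right (by linarith)]
  have hWm := aemeasurable_bernoulliSum law u
  have hWi := (memLp_bernoulliSum law u).integrable one_le_two
  set E := {w | bernoulliSum p u X w ∈ Set.Icc a b} with hE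
  have hEm : NullMeasurableSet E P := hWm.nullMeasurableSet_preimage measurableSet_Icc
  have lower : ∀ᵐ w ∂P, E.indicator (fun _ => (1 / 2 : ℝ)) w ≤
      ∑ k, steinIncrement p u X g k w := by
    filter_upwards [ae_all_iff.2 fun k => ae_eq_one_or_zero (law k)] with w hw
    by_cases hwE : w ∈ E
    · rw [Set.indicator_of_mem hwE]
      -- For `|u k| > 2 * γ` the left side is negative and monotonicity is enough. The left sides
      -- add up to `1 - 1 / 2`.
      have : ∀ k, u k ^ 2 - |u k| ^ 3 / (2 * γ) ≤ steinIncrement p u X g k w := fun k => by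
        rcases le_or_gt |u k| (2 * γ) with hk | hk
        · rw [steinIncrement_eq_sq hp0 hp1 u k (hw k) (m := m)]
          · have : 0 ≤ |u k| ^ 3 / (2 * γ) := by positivity
            linarith
          · intro x hx
            have h1 : |u k| / s ≤ δ := by rw [hδ]; gcongr
            have h2 := abs_le.1 (hx.trans h1)
            exact hglin x (by linarith [hwE.1]) (by linarith [hwE.2])
        · refine le_trans ?_ (steinIncrement_nonneg_of_monotone hp0 hp1 u hgm k w)
          rw [sub_nonpos, le_div_iff₀ (by positivity), ← sq_abs, pow_succ _ 2]
          gcongr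
      refine le_trans ?_ (Finset.sum_le_sum fun k _ => this k)
      rw [Finset.sum_sub_distrib, hu, ← Finset.sum_div]
      rw [← hγdef]
      field_simp
      norm_num
    · rw [Set.indicator_of_notMem hwE]
      exact Finset.sum_nonneg fun k _ => steinIncrement_nonneg_of_monotone hp0 hp1 u hgm k w
  have hmono := integral_mono_ae ((integrable_const (1 / 2 : ℝ)).indicator₀ hEm)
    (integrable_finsetSum _ fun k _ => integrable_steinIncrement law u hgmeas hgM k) lower
  rw [← integral_bernoulliSum_mul_comp hp0 hp1 indep law u hgmeas hgM,
    integral_indicator_const_of_nullMeasurableSet hEm] at hmono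
  have hup : ∫ w, bernoulliSum p u X w * g (bernoulliSum p u X w) ∂P ≤ h := by
    calc _ ≤ ∫ w, |bernoulliSum p u X w| * h ∂P := by
          refine integral_mono (integrable_mul_comp_bernoulliSum law u hWi hgmeas hgM)
            (hWi.abs.mul_const h) fun w => ?_
          refine (le_abs_self _).trans ?_
          rw [abs_mul]
          exact mul_le_mul_of_nonneg_left (hgM _) (abs_nonneg _)
      _ ≤ h := by
          rw [integral_mul_const]
          exact mul_le_of_le_one_left hh0.le (integral_abs_bernoulliSum_le hp0 hp1 indep law hu)
  have e : 4 * γ / s = 2 * δ := by rw [hδ]; ring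
  rw [e]
  linarith

/-- The **Berry–Esseen theorem** for linear combinations of standardized Bernoulli variables. -/
theorem abs_measureReal_bernoulliSum_le_sub_le (hp0 : 0 < p) (hp1 : p < 1)
    (indep : iIndepFun X P) (law : ∀ k, HasLaw (X k) (bernoulliMeasure (1 : ℝ) 0 p) P)
    {u : ι → ℝ} (hu : ∑ k, u k ^ 2 = 1) (z : ℝ) :
    |P.real {w | bernoulliSum p u X w ≤ z} - gaussianCDF z| ≤
      ((gaussianDensity 1)⁻¹ + 8) / bernoulliStd p * ∑ k, |u k| ^ 3 := by
  have hs := bernoulliStd_pos hp0 hp1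
  have hWm := aemeasurable_bernoulliSum law u
  have hWi := (memLp_bernoulliSum law u).integrable one_le_two
  have hfm := (continuous_steinSolution z).measurable
  have hfM := abs_steinSolution_le z
  set W := bernoulliSum p u X with hW
  set s := bernoulliStd p
  set K := (gaussianDensity 1)⁻¹
  set γ := ∑ k, |u k| ^ 3
  have hE : NullMeasurableSet {w | W w ≤ z} P := hWm.nullMeasurableSet_preimage measurableSet_Iic
  have hEk : ∀ k, NullMeasurableSet {w | |W w - z| ≤ |u k| / s} P := fun k =>
    hWm.nullMeasurableSet_preimage (s := {x | |x - z| ≤ |u k| / s})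
      (measurableSet_le (by fun_prop) (by fun_prop))
  have hi1 : Integrable (fun w => W w * steinSolution z (W w)) P :=
    integrable_mul_comp_bernoulliSum law u hWi hfm hfM
  have hi2 : Integrable ({w | W w ≤ z}.indicator fun _ => (1 : ℝ)) P :=
    (integrable_const 1).indicator₀ hE
  have hi3 : ∀ k, Integrable ({w | |W w - z| ≤ |u k| / s}.indicator fun _ => (1 : ℝ)) P :=
    fun k => (integrable_const 1).indicator₀ (hEk k)
  have hi4 : Integrable (fun w => ∑ k, steinIncrement p u X (steinSolution z) k w) P :=
    integrable_finsetSum _ fun k _ => integrable_steinIncrement law u hfm hfM k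
  have hi5 : ∀ k, Integrable (fun w => u k ^ 2 * ((2 * |W w| + K) * (|u k| / s) +
      {w | |W w - z| ≤ |u k| / s}.indicator (fun _ => (1 : ℝ)) w)) P := fun k =>
    (((((hWi.abs.const_mul 2).add (integrable_const K)).mul_const _).add (hi3 k)).const_mul _)
  have bound : ∀ᵐ w ∂P, |∑ k, steinIncrement p u X (steinSolution z) k w -
      (W w * steinSolution z (W w) + {w | W w ≤ z}.indicator (fun _ => (1 : ℝ)) w -
        gaussianCDF z)| ≤ ∑ k, u k ^ 2 * ((2 * |W w| + K) * (|u k| / s) +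
      {w | |W w - z| ≤ |u k| / s}.indicator (fun _ => (1 : ℝ)) w) := by
    filter_upwards [ae_all_iff.2 fun k => ae_eq_one_or_zero (law k)] with w hw
    have e : ∀ c : ℝ, ∑ k, steinIncrement p u X (steinSolution z) k w - c =
        ∑ k, (steinIncrement p u X (steinSolution z) k w - u k ^ 2 * c) := fun c => by
      rw [Finset.sum_sub_distrib, ← Finset.sum_mul, hu, one_mul]
    rw [e]
    refine (Finset.abs_sum_le_sum_abs _ _).trans (Finset.sum_le_sum fun k _ => ?_)
    have := abs_steinIncrement_sub_le hp0 hp1 u z k (hw k)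
    simpa only [Set.indicator_apply, Set.mem_ofPred_eq] using this
  -- The increments integrate to `E[W f(W)]`, which cancels and leaves only the quantity to be
  -- estimated.
  have hint : ∫ w, (∑ k, steinIncrement p u X (steinSolution z) k w -
      (W w * steinSolution z (W w) + {w | W w ≤ z}.indicator (fun _ => (1 : ℝ)) w -
        gaussianCDF z)) ∂P = -(P.real {w | W w ≤ z} - gaussianCDF z) := by
    rw [integral_sub hi4 ((hi1.fun_add hi2).sub' (integrable_const _)),
      integral_sub (hi1.fun_add hi2) (integrable_const _), integral_add hi1 hi2,
      ← integral_bernoulliSum_mul_comp hp0 hp1 indep law u hfm hfM,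
      integral_indicator_const_of_nullMeasurableSet hE]
    simp [← hW]
    ring
  rw [← abs_neg, ← hint]
  refine (abs_integral_le_integral_abs).trans ((integral_mono_ae
    (hi4.sub ((hi1.fun_add hi2).sub' (integrable_const _))).abs
    (integrable_finsetSum _ fun k _ => hi5 k) bound).trans ?_)
  rw [integral_finsetSum _ fun k _ => hi5 k]
  -- `E|W| ≤ 1` contributes `K + 2`, and concentration on an interval of length `2 * |u k| / s`
  -- contributes the other `2` and the term in `γ`. Summation turns that term into `4 * γ / s`,
  -- whence `K + 8`.
  have hterm : ∀ k, ∫ w, u k ^ 2 * ((2 * |W w| + K) * (|u k| / s) +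
      {w | |W w - z| ≤ |u k| / s}.indicator (fun _ => (1 : ℝ)) w) ∂P ≤
      (K + 4) / s * |u k| ^ 3 + 4 * γ / s * u k ^ 2 := fun k => by
    have hD : 0 ≤ |u k| / s := by positivity
    rw [integral_const_mul, integral_add (((hWi.abs.const_mul 2).fun_add
      (integrable_const K)).mul_const _) (hi3 k), integral_mul_const,
      integral_add (hWi.abs.const_mul 2) (integrable_const K), integral_const_mul,
      integral_indicator_const_of_nullMeasurableSet (hEk k)]
    have h1 := integral_abs_bernoulliSum_le hp0 hp1 indep law hu
    have h2 := measureReal_bernoulliSum_mem_Icc_le hp0 hp1 indep law hu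
      (a := z - |u k| / s) (b := z + |u k| / s) (by linarith)
    have h3 : {w | |W w - z| ≤ |u k| / s} =
        {w | bernoulliSum p u X w ∈ Set.Icc (z - |u k| / s) (z + |u k| / s)} := by
      ext w
      rw [Set.mem_ofPred_eq, Set.mem_ofPred_eq, Set.mem_Icc, abs_le]
      constructor <;> rintro ⟨h, h'⟩ <;> constructor <;> linarith
    rw [← h3] at h2
    calc _ ≤ u k ^ 2 * ((2 * 1 + K) * (|u k| / s) +
          ((z + |u k| / s - (z - |u k| / s)) + 4 * γ / s)) := by
          simp only [integral_const, probReal_univ, smul_eq_mul, one_mul, mul_one]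
          gcongr
          simpa using h1
      _ = _ := by
          rw [pow_succ |u k| 2, sq_abs]; ring
  refine (Finset.sum_le_sum fun k _ => hterm k).trans (le_of_eq ?_)
  rw [Finset.sum_add_distrib, ← Finset.mul_sum, ← Finset.mul_sum, hu]
  ring

end BernoulliSum

/-! ### Characteristic functions of Bernoulli sums. -/

lemma norm_prod_sub_prod_le {ι : Type*} (s : Finset ι) {a b : ι → ℂ}
    (ha : ∀ i, ‖a i‖ ≤ 1) (hb : ∀ i, ‖b i‖ ≤ 1) :
    ‖∏ i ∈ s, a i - ∏ i ∈ s, b i‖ ≤ ∑ i ∈ s, ‖a i - b i‖ := by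
  classical
  induction s using Finset.induction_on with
  | empty => simp
  | insert i s hi ih =>
    rw [Finset.prod_insert hi, Finset.prod_insert hi, Finset.sum_insert hi]
    have e : a i * ∏ j ∈ s, a j - b i * ∏ j ∈ s, b j =
        (a i - b i) * ∏ j ∈ s, a j + b i * (∏ j ∈ s, a j - ∏ j ∈ s, b j) := by ring
    rw [e]
    refine (norm_add_le _ _).trans ?_
    rw [norm_mul, norm_mul]
    have h1 : ‖∏ j ∈ s, a j‖ ≤ 1 := by
      rw [norm_prod]; exact Finset.prod_le_one (fun _ _ => norm_nonneg _) fun j _ => ha j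
    exact add_le_add (mul_le_of_le_one_right (norm_nonneg _) h1)
      ((mul_le_of_le_one_left (norm_nonneg _) (hb i)).trans ih)

/-- If `ψ` is bounded by one and has the second order expansion `1 - t² / 2` at zero, then products
of values of `ψ` at small arguments are close to a Gaussian characteristic function. -/
lemma exists_norm_prod_sub_exp_le {ψ : ℝ → ℂ} (hψ : ∀ t, ‖ψ t‖ ≤ 1)
    (hψ2 : (fun t => ψ t - (1 - (t : ℂ) ^ 2 / 2)) =o[𝓝 0] fun t : ℝ => t ^ 2)
    {η : ℝ} (hη : 0 < η) :
    ∃ δ > 0, ∀ (ι : Type) [Fintype ι] (c : ι → ℝ), (∀ i, |c i| < δ) →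
      ‖∏ i, ψ (c i) - Complex.exp (-((∑ i, c i ^ 2 : ℝ) : ℂ) / 2)‖ ≤ η * ∑ i, c i ^ 2 := by
  have hmean : (gaussianReal 0 1)[(id : ℝ → ℝ)] = 0 := by simp
  have hvar : (gaussianReal 0 1)[(id : ℝ → ℝ) ^ 2] = 1 := by
    have h := variance_id_gaussianReal (μ := 0) (v := 1)
    rw [variance_of_integral_eq_zero aemeasurable_id hmean] at h
    simpa using h
  -- The Gaussian has the same first two moments, so both expansions agree to second order. The
  -- resulting `δ` works for every index set, as needed when the number of factors grows.
  have hexp : (fun t : ℝ => Complex.exp (-(t : ℂ) ^ 2 / 2) - (1 - (t : ℂ) ^ 2 / 2)) =o[𝓝 0]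
      fun t : ℝ => t ^ 2 := by
    have := taylor_charFun_two (P := gaussianReal 0 1) aemeasurable_id hmean hvar
    simpa [charFun_gaussianReal, neg_div] using this
  have hdiff := (hψ2.sub hexp).def hη
  obtain ⟨δ, hδ, H⟩ := Metric.eventually_nhds_iff.1 hdiff
  refine ⟨δ, hδ, fun ι _ c hc => ?_⟩
  have e : Complex.exp (-((∑ i, c i ^ 2 : ℝ) : ℂ) / 2) =
      ∏ i, Complex.exp (-(c i : ℂ) ^ 2 / 2) := by
    rw [← Complex.exp_sum]
    congr 1
    push_cast
    rw [← Finset.sum_div, Finset.sum_neg_distrib]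
  rw [e, Finset.mul_sum]
  refine (norm_prod_sub_prod_le _ (fun i => hψ _) fun i => ?_).trans
    (Finset.sum_le_sum fun i _ => ?_)
  · rw [Complex.norm_exp, Real.exp_le_one_iff, ← Complex.ofReal_pow, ← Complex.ofReal_neg,
      Complex.div_ofNat_re, Complex.ofReal_re]
    nlinarith [sq_nonneg (c i)]
  · have := H (y := c i) (by simpa using hc i)
    simpa using this

section BernoulliCharFun

variable {p : unitInterval}

/-- The characteristic function of a standardized Bernoulli variable. -/
noncomputable def bernoulliCharFun (p : unitInterval) : ℝ → ℂ :=
  charFun ((bernoulliMeasure (1 : ℝ) 0 p).map (bernoulliStandardize p))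

lemma norm_bernoulliCharFun_le (t : ℝ) : ‖bernoulliCharFun p t‖ ≤ 1 := by
  have := Measure.isProbabilityMeasure_map (μ := bernoulliMeasure (1 : ℝ) 0 p)
    (measurable_bernoulliStandardize p).aemeasurable
  exact norm_charFun_le_one t

lemma bernoulliCharFun_isLittleO (hp0 : 0 < p) (hp1 : p < 1) :
    (fun t => bernoulliCharFun p t - (1 - (t : ℂ) ^ 2 / 2)) =o[𝓝 0] fun t : ℝ => t ^ 2 :=
  taylor_charFun_two (measurable_bernoulliStandardize p).aemeasurable
    integral_bernoulliStandardize (integral_bernoulliStandardize_sq hp0 hp1)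

/-- The argument `1` loses nothing, since the frequency can be absorbed into the coefficients. -/
lemma charFun_map_bernoulliSum {S ι : Type*} [MeasurableSpace S] {P : Measure S} [Fintype ι]
    {X : ι → S → ℝ} (indep : iIndepFun X P)
    (law : ∀ k, HasLaw (X k) (bernoulliMeasure (1 : ℝ) 0 p) P) (u : ι → ℝ) :
    charFun (P.map (bernoulliSum p u X)) 1 = ∏ k, bernoulliCharFun p (u k) := by
  have hm := measurable_bernoulliStandardize p
  have h := iIndepFun.charFun_map_fun_sum_eq_prod
    (fun k => (hm.comp_aemeasurable (law k).aemeasurable).const_mul (u k))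
    (indep.comp (fun k x => u k * bernoulliStandardize p x) fun k => hm.const_mul _)
  unfold bernoulliSum
  refine (congrFun h 1).trans ?_
  rw [Finset.prod_apply]
  refine Finset.prod_congr rfl fun k _ => ?_
  refine (charFun_map_mul_comp (hm.comp_aemeasurable (law k).aemeasurable) (u k) 1).trans ?_
  rw [mul_one, bernoulliCharFun, ← (law k).map_eq,
    AEMeasurable.map_map_of_aemeasurable hm.aemeasurable (law k).aemeasurable]

end BernoulliCharFun

/-! ### Linear forms in a block of `U Ω`. -/

section Block

variable {n m r s : ℕ}

/-- The coefficients of the linear form `∑ a, t a * (U Ω) (ρ a.1) (κ a.2)` in the entries of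
`Ω`. -/
def blockCoeff (U : Matrix (Fin n) (Fin n) ℝ) (ρ : Fin r ↪ Fin n) (κ : Fin s ↪ Fin m)
    (t : Fin r × Fin s → ℝ) (a : Fin n × Fin m) : ℝ :=
  ∑ b, if κ b.2 = a.2 then t b * U (ρ b.1) a.1 else 0

lemma sum_mul_mul_apply_eq (U : Matrix (Fin n) (Fin n) ℝ) (ρ : Fin r ↪ Fin n)
    (κ : Fin s ↪ Fin m) (t : Fin r × Fin s → ℝ) (Om : Matrix (Fin n) (Fin m) ℝ) :
    ∑ b, t b * (U * Om) (ρ b.1) (κ b.2) = ∑ a, blockCoeff U ρ κ t a * Om a.1 a.2 := by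
  simp_rw [blockCoeff, Finset.sum_mul]
  rw [Finset.sum_comm]
  refine Finset.sum_congr rfl fun b _ => ?_
  rw [Matrix.mul_apply, Finset.mul_sum, Fintype.sum_prod_type]
  refine Finset.sum_congr rfl fun k _ => ?_
  simp [ite_mul, mul_assoc]

lemma sum_row_mul_row {U : Matrix (Fin n) (Fin n) ℝ}
    (hU : U ∈ Matrix.orthogonalGroup (Fin n) ℝ) (i j : Fin n) :
    ∑ k, U i k * U j k = if i = j then 1 else 0 := by
  have h := congrFun (congrFun ((Matrix.mem_orthogonalGroup_iff _ _).1 hU) i) j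
  rw [Matrix.mul_apply, Matrix.one_apply] at h
  simpa [Matrix.star_apply] using h

/-- Expanding the square, positions in different columns have coefficients with disjoint supports,
and positions in different rows are orthogonal because the rows of `U` are orthonormal. Only the
diagonal survives. -/
lemma sum_blockCoeff_sq {U : Matrix (Fin n) (Fin n) ℝ}
    (hU : U ∈ Matrix.orthogonalGroup (Fin n) ℝ) (ρ : Fin r ↪ Fin n) (κ : Fin s ↪ Fin m)
    (t : Fin r × Fin s → ℝ) : ∑ a, blockCoeff U ρ κ t a ^ 2 = ∑ b, t b ^ 2 := by
  have e : ∀ a, blockCoeff U ρ κ t a ^ 2 = ∑ b, ∑ c,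
      if κ b.2 = a.2 ∧ κ c.2 = a.2 then t b * t c * (U (ρ b.1) a.1 * U (ρ c.1) a.1) else 0 := by
    intro a
    rw [sq, blockCoeff, Finset.sum_mul_sum]
    refine Finset.sum_congr rfl fun b _ => Finset.sum_congr rfl fun c _ => ?_
    by_cases h1 : κ b.2 = a.2 <;> by_cases h2 : κ c.2 = a.2 <;> simp [h1, h2]
    ring
  simp_rw [e]
  rw [Finset.sum_comm]
  refine Finset.sum_congr rfl fun b _ => ?_
  rw [Finset.sum_comm]
  have e2 : ∀ c, (∑ a : Fin n × Fin m, if κ b.2 = a.2 ∧ κ c.2 = a.2 then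
      t b * t c * (U (ρ b.1) a.1 * U (ρ c.1) a.1) else 0) =
      if c = b then t b ^ 2 else 0 := by
    intro c
    rw [Fintype.sum_prod_type_right]
    have : ∀ y : Fin m, (∑ x : Fin n, if κ b.2 = y ∧ κ c.2 = y then
        t b * t c * (U (ρ b.1) x * U (ρ c.1) x) else 0) =
        if κ b.2 = y then (if c = b then t b ^ 2 else 0) else 0 := by
      intro y
      by_cases hb : κ b.2 = y
      · by_cases hc : κ c.2 = y
        · have h2 : c.2 = b.2 := κ.injective (hc.trans hb.symm)
          simp only [hb, hc, and_self, if_true]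
          rw [← Finset.mul_sum, sum_row_mul_row hU]
          by_cases h1 : c.1 = b.1
          · have : c = b := Prod.ext h1 h2
            simp [this, sq]
          · have : c ≠ b := fun h => h1 (by rw [h])
            have h1' : ¬ b.1 = c.1 := fun h => h1 h.symm
            simp [this, h1']
        · have : c ≠ b := fun h => hc (by rw [h, hb])
          simp [hc, this]
      · simp [hb]
    simp_rw [this]
    simp
  simp_rw [e2]
  simp

lemma abs_blockCoeff_le {U : Matrix (Fin n) (Fin n) ℝ} {ε : ℝ} (hε : ∀ i j, |U i j| ≤ ε)
    (ρ : Fin r ↪ Fin n) (κ : Fin s ↪ Fin m) (t : Fin r × Fin s → ℝ) (a : Fin n × Fin m) :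
    |blockCoeff U ρ κ t a| ≤ (∑ b, |t b|) * ε := by
  rw [blockCoeff, Finset.sum_mul]
  refine (Finset.abs_sum_le_sum_abs _ _).trans (Finset.sum_le_sum fun b _ => ?_)
  have h : |t b * U (ρ b.1) a.1| ≤ |t b| * ε := by
    rw [abs_mul]; exact mul_le_mul_of_nonneg_left (hε _ _) (abs_nonneg _)
  split_ifs
  · exact h
  · simpa using (abs_nonneg _).trans h

end Block

/-! ### The limit theorem and the bound for entries. -/

lemma IsStandardizedBernoulliMatrix.exists_bernoulli {S : Type*} [MeasurableSpace S] {P : Measure S}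
    {p : unitInterval} {n l : ℕ} {Om : S → Matrix (Fin n) (Fin l) ℝ}
    (h : IsStandardizedBernoulliMatrix P p Om) :
    ∃ X : Fin n × Fin l → S → ℝ, iIndepFun X P ∧
      (∀ a, HasLaw (X a) (bernoulliMeasure (1 : ℝ) 0 p) P) ∧
      ∀ w i j, Om w i j = bernoulliStandardize p (X (i, j) w) := by
  obtain ⟨B, hB, hOm⟩ := h
  exact ⟨fun a w => B w a.1 a.2, hB.indep, fun a => hB.law a.1 a.2, hOm⟩

lemma charFun_toLp_standardGaussianMatrix (r s : ℕ) (t : EuclideanSpace ℝ (Fin r × Fin s)) :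
    charFun ((standardGaussianMatrix r s).map (WithLp.toLp 2)) t =
      Complex.exp (-((∑ b, t b ^ 2 : ℝ) : ℂ) / 2) := by
  rw [standardGaussianMatrix, charFun_pi]
  simp_rw [charFun_gaussianReal]
  rw [← Complex.exp_sum]
  congr 1
  push_cast
  simp [← Finset.sum_div, Finset.sum_neg_distrib, neg_div]

/-- Blocks of `U Ω` converge in distribution to a standard Gaussian matrix. -/
theorem tendstoStandardGaussianMatrix_mul {p : unitInterval} (hp0 : 0 < p) (hp1 : p < 1)
    {l : ℕ → ℕ} {S : ℕ → Type*} [∀ n, MeasurableSpace (S n)] {P : ∀ n, Measure (S n)}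
    [∀ n, IsProbabilityMeasure (P n)] {Om : ∀ n, S n → Matrix (Fin n) (Fin (l n)) ℝ}
    {U : ∀ n, Matrix (Fin n) (Fin n) ℝ} {ε : ℕ → ℝ}
    (hOm : ∀ n, IsStandardizedBernoulliMatrix (P n) p (Om n))
    (hU : ∀ n, U n ∈ Matrix.orthogonalGroup (Fin n) ℝ)
    (hε : ∀ n i j, |U n i j| ≤ ε n) (hε0 : Tendsto ε atTop (𝓝 0)) :
    TendstoStandardGaussianMatrix P (fun n w => U n * Om n w) := by
  intro r s φ hφ ρ κ
  choose X indep law hX using fun n => (hOm n).exists_bernoulli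
  have hentry : ∀ n i j, AEMeasurable (fun w => (U n * Om n w) i j) (P n) := by
    intro n i j
    simp_rw [Matrix.mul_apply, hX]
    exact Finset.aemeasurable_fun_sum _ fun k _ => ((measurable_bernoulliStandardize
      p).comp_aemeasurable (law n (k, j)).aemeasurable).const_mul _
  have hY : ∀ k, AEMeasurable (fun (w : S (φ k)) (a : Fin r × Fin s) =>
      (U (φ k) * Om (φ k) w) (ρ k a.1) (κ k a.2)) (P (φ k)) := fun k =>
    aemeasurable_pi_lambda _ fun a => hentry _ _ _
  -- Lévy's continuity theorem is applied in Euclidean space, where the inner product is available;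
  -- the continuous map `WithLp.ofLp` then brings the result back.
  have main : TendstoInDistribution (fun k (w : S (φ k)) =>
      (WithLp.toLp 2 fun a : Fin r × Fin s => (U (φ k) * Om (φ k) w) (ρ k a.1) (κ k a.2) :
        EuclideanSpace ℝ (Fin r × Fin s))) atTop (WithLp.toLp 2) (fun k => P (φ k))
      (standardGaussianMatrix r s) := by
    have hm : Measurable (WithLp.toLp 2 : (Fin r × Fin s → ℝ) → EuclideanSpace ℝ _) := by
      fun_prop
    refine ⟨fun k => hm.comp_aemeasurable (hY k), hm.aemeasurable, ?_⟩
    refine ProbabilityMeasure.tendsto_iff_tendsto_charFun.2 fun t => ?_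
    simp only [ProbabilityMeasure.coe_mk]
    rw [charFun_toLp_standardGaussianMatrix]
    have hchar : ∀ k, charFun ((P (φ k)).map fun w => (WithLp.toLp 2 fun a : Fin r × Fin s =>
        (U (φ k) * Om (φ k) w) (ρ k a.1) (κ k a.2) : EuclideanSpace ℝ (Fin r × Fin s))) t =
        ∏ a, bernoulliCharFun p (blockCoeff (U (φ k)) (ρ k) (κ k) t a) := by
      intro k
      rw [← charFun_map_bernoulliSum (indep (φ k)) (law (φ k)), charFun_apply, charFun_apply,
        integral_map (aemeasurable_bernoulliSum (law (φ k)) _) (by fun_prop)]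
      refine (integral_map (hm.comp_aemeasurable (hY k))
        (Continuous.aestronglyMeasurable (by fun_prop))).trans
        (integral_congr_ae (ae_of_all _ fun w => ?_))
      have h := sum_mul_mul_apply_eq (U (φ k)) (ρ k) (κ k) t (Om (φ k) w)
      simp only [hX] at h
      simp only [bernoulliSum]
      rw [← h]
      simp [PiLp.inner_apply]
    simp_rw [hchar]
    rw [Metric.tendsto_atTop']
    intro η hη
    set σ := ∑ b, t b ^ 2 with hσ
    have hσ0 : 0 ≤ σ := Finset.sum_nonneg fun _ _ => sq_nonneg _
    -- The error is at most this constant times `σ`; dividing by `σ + 1` also covers `σ = 0` and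
    -- makes the final inequality strict.
    obtain ⟨δ, hδ, H⟩ := exists_norm_prod_sub_exp_le norm_bernoulliCharFun_le
      (bernoulliCharFun_isLittleO hp0 hp1) (show 0 < η / (σ + 1) by positivity)
    have hlim : Tendsto (fun k => (∑ b, |t b|) * ε (φ k)) atTop (𝓝 0) := by
      simpa using (hε0.comp hφ).const_mul (∑ b, |t b|)
    obtain ⟨N, hN⟩ := eventually_atTop.1 (hlim.eventually_lt_const hδ)
    refine ⟨N, fun k hk => ?_⟩
    have := H _ (blockCoeff (U (φ k)) (ρ k) (κ k) t) fun a =>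
      (abs_blockCoeff_le (hε (φ k)) _ _ _ a).trans_lt (hN k hk.le)
    rw [sum_blockCoeff_sq (hU (φ k)), ← hσ] at this
    rw [dist_eq_norm]
    refine this.trans_lt ?_
    rw [div_mul_eq_mul_div, div_lt_iff₀ (by positivity)]
    nlinarith
  exact main.continuous_comp (g := WithLp.ofLp) (by fun_prop)

lemma kolmogorovDist_le {μ ν : Measure ℝ} {c : ℝ}
    (h : ∀ x, |μ.real (Set.Iic x) - ν.real (Set.Iic x)| ≤ c) : kolmogorovDist μ ν ≤ c :=
  ciSup_le h

/-- Berry–Esseen bound for the entries of `U Ω`. -/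
theorem kolmogorovDist_mul_apply_le {p : unitInterval} (hp0 : 0 < p) (hp1 : p < 1)
    {S : Type*} [MeasurableSpace S] {P : Measure S} [IsProbabilityMeasure P] {n l : ℕ}
    {Om : S → Matrix (Fin n) (Fin l) ℝ} (hOm : IsStandardizedBernoulliMatrix P p Om)
    {U : Matrix (Fin n) (Fin n) ℝ} (hU : U ∈ Matrix.orthogonalGroup (Fin n) ℝ)
    (i : Fin n) (j : Fin l) :
    kolmogorovDist (P.map fun w => (U * Om w) i j) (gaussianReal 0 1) ≤
      ((gaussianDensity 1)⁻¹ + 8) / bernoulliStd p * ∑ k, |U i k| ^ 3 := by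
  obtain ⟨X, indep, law, hX⟩ := hOm.exists_bernoulli
  have e : (fun w => (U * Om w) i j) = bernoulliSum p (U i) fun k => X (k, j) := by
    ext w
    simp_rw [Matrix.mul_apply, hX, bernoulliSum]
  have hrow : ∑ k, U i k ^ 2 = 1 := by
    simpa [sq] using sum_row_mul_row hU i i
  refine kolmogorovDist_le fun x => ?_
  rw [e, map_measureReal_apply_of_aemeasurable
    (aemeasurable_bernoulliSum (fun k => law (k, j)) _) measurableSet_Iic]
  exact abs_measureReal_bernoulliSum_le_sub_le hp0 hp1
    -- Only column `j` of the Bernoulli matrix enters, and a subfamily of an independent family is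
    -- independent.
    (indep.precomp (g := fun k => (k, j)) fun a b h => (Prod.mk.inj h).1)
    (fun k => law (k, j)) hrow x

theorem theorem3p2 (p : unitInterval) (hp0 : 0 < p) (hp1 : p < 1) :
    ∃ C : ℝ, 0 < C ∧
      ∀ (l : ℕ → ℕ) (S : ℕ → Type*) [∀ n, MeasurableSpace (S n)] (P : ∀ n, Measure (S n))
        [∀ n, IsProbabilityMeasure (P n)]
        (Om : ∀ n, S n → Matrix (Fin n) (Fin (l n)) ℝ)
        (U : ∀ n, Matrix (Fin n) (Fin n) ℝ) (ε : ℕ → ℝ),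
        (∀ n, IsStandardizedBernoulliMatrix (P n) p (Om n)) →
        (∀ n, U n ∈ Matrix.orthogonalGroup (Fin n) ℝ) →
        (∀ n i j, |U n i j| ≤ ε n) → Tendsto ε atTop (𝓝 0) →
        TendstoStandardGaussianMatrix P (fun n w => U n * Om n w) ∧
        ∀ n i j,
          kolmogorovDist ((P n).map fun w => (U n * Om n w) i j) (gaussianReal 0 1)
            ≤ C * ∑ k, |U n i k| ^ 3 := by
  have hs := bernoulliStd_pos hp0 hp1
  have hd := inv_pos.2 (gaussianDensity_pos 1)
  refine ⟨((gaussianDensity 1)⁻¹ + 8) / bernoulliStd p, by positivity, ?_⟩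
  intro l S _ P _ Om U ε hOm hU hε hε0
  exact ⟨tendstoStandardGaussianMatrix_mul hp0 hp1 hOm hU hε hε0,
    fun n i j => kolmogorovDist_mul_apply_le hp0 hp1 (hOm n) (hU n) i j⟩
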